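/- **Conventions.** A real $(n_1,\dots,n_d)$-tensor is a table $A=(a_{i_1\dots i_d})$ of real numbers, with Frobenius inner product $\langle A,B\rangle_F=\sum_{i_1,\dots,i_d}a_{i_1\dots i_d}b_{i_1\dots i_d}$ and norm $\|A\|_F=\sqrt{\langle A,A\rangle_F}$. A rank-one tensor is a nonzero tensor of the form $x^{(1)}\otimes\dots\otimes x^{(d)}=(x^{(1)}_{i_1}\cdots x^{(d)}_{i_d})$ with $x^{(j)}\in\mathbb R^{n_j}$. The spectral norm is $$\|A\|_2=\max\{\langle A,x^{(1)}\otimes\dots\otimes x^{(d)}\rangle_F : \|x^{(1)}\|=\dots=\|x^{(d)}\|=1\},$$ where $\|\cdot\|$ is the Euclidean norm. For a space $V$ of tensors, the best rank-one approximation ratio is $$\mathscr A(V)=\min_{0\ne A\in V}\frac{\|A\|_2}{\|A\|_F};$$ a nonzero tensor is called extremal if it attains this minimum for the space of all tensors of its format. The orthogonal rank $\mathrm{rk}_\perp(A)$ is the least $r$ such that $A=Y_1+\dots+Y_r$ with rank-one tensors $Y_1,\dots,Y_r$ that are pairwise orthogonal for $\langle\cdot,\cdot\rangle_F$. $\mathrm{Sym}^3(\mathbb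 R^3)$ is the space of $(3,3,3)$-tensors whose entries are invariant under permutations of the indices; to $A\in\mathrm{Sym}^3(\mathbb R^3)$ corresponds the cubic form $p_A(x)=\sum_{i,j,k=1}^3a_{ijk}x_ix_jx_k$. For a real ternary cubic form $p=\sum_{|\alpha|=3}c_\alpha x^\alpha$ let $$\|p\|_\infty=\max_{\|x\|=1}|p(x)|,\qquad \|p\|_B=\Bigl(\sum_{|\alpha|=3}\tbinom{3}{\alpha}^{-1}c_\alpha^2\Bigr)^{1/2},\qquad \tbinom3\alpha=\frac{3!}{\alpha_1!\,\alpha_2!\,\alpha_3!}.$$ The group $CO(3)=\mathbb R_{>0}\times O(3)$ acts on forms by $(g^*p)(x)=s\,p(\rho^{-1}x)$ for $g=(s,\rho)$. Let $T(x)=x_1^3-3x_1(x_2^2+x_3^2)$ be the ternary Chebyshev cubic. **Theorem.** 1. The minima defining the two ratios below exist, the maximum of $\mathrm{rk}_\perp$ over all $(3,3,3)$-tensors exists and equals $7$, and $$\mathscr A(\mathbb R^3\otimes\mathbb R^3\otimes\mathbb R^3)=\mathscr A(\mathrm{Sym}^3(\mathbb R^3))=\frac1{\sqrt{\max_{A\in\mathbb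 R^3\otimes\mathbb R^3\otimes\mathbb R^3}\mathrm{rk}_\perp(A)}}=\frac1{\sqrt7}.$$ 2. There is exactly one symmetric $(3,3,3)$-tensor $A$ with $p_A=T$, and it is extremal in $\mathbb R^3\otimes\mathbb R^3\otimes\mathbb R^3$. 3. Every nonzero real ternary cubic form $p$ satisfies $\|p\|_\infty/\|p\|_B\ge 1/\sqrt7$. For every $g\in CO(3)$ the form $g^*T$ is a nonzero ternary cubic form, and $\|g^*T\|_\infty/\|g^*T\|_B=1/\sqrt7$. -/

import Mathlib

open scoped InnerProductSpace

/-- Real `(n₁, …, n_d)`-tensors, as tables of real numbers. The Euclidean structure is the Frobenius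
one: `⟪A, B⟫_ℝ = ∑ i, A i * B i`, and `‖A‖` is the Frobenius norm. -/
abbrev Tensor {d : ℕ} (n : Fin d → ℕ) : Type := EuclideanSpace ℝ ((j : Fin d) → Fin (n j))

/-- The outer product `x⁽¹⁾ ⊗ ⋯ ⊗ x⁽ᵈ⁾`. -/
def outerProduct {d : ℕ} {n : Fin d → ℕ} (x : (j : Fin d) → EuclideanSpace ℝ (Fin (n j))) :
    Tensor n :=
  WithLp.toLp 2 fun i => ∏ j, x j (i j)

/-- Rank-one tensors: nonzero outer products. -/
def IsRankOne {d : ℕ} {n : Fin d → ℕ} (A : Tensor n) : Prop :=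
  A ≠ 0 ∧ ∃ x : (j : Fin d) → EuclideanSpace ℝ (Fin (n j)), A = outerProduct x

/-- The spectral norm: the maximum of `⟪A, x⁽¹⁾ ⊗ ⋯ ⊗ x⁽ᵈ⁾⟫` over unit vectors `x⁽ʲ⁾`. -/
noncomputable def tensorSpectralNorm {d : ℕ} {n : Fin d → ℕ} (A : Tensor n) : ℝ :=
  sSup {t : ℝ | ∃ x : (j : Fin d) → EuclideanSpace ℝ (Fin (n j)),
    (∀ j, ‖x j‖ = 1) ∧ t = ⟪A, outerProduct x⟫_ℝ}

/-- The quotients `‖A‖₂ / ‖A‖_F` for nonzero tensors `A` in a set `V` of tensors. -/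
def normRatios {d : ℕ} {n : Fin d → ℕ} (V : Set (Tensor n)) : Set ℝ :=
  {t : ℝ | ∃ A ∈ V, A ≠ 0 ∧ t = tensorSpectralNorm A / ‖A‖}

/-- The best rank-one approximation ratio of a space `V` of tensors. -/
noncomputable def bestRankOneRatio {d : ℕ} {n : Fin d → ℕ} (V : Set (Tensor n)) : ℝ :=
  sInf (normRatios V)

/-- A nonzero tensor is extremal if it minimizes `‖A‖₂ / ‖A‖_F` over all nonzero tensors of its
format. -/
def IsExtremal {d : ℕ} {n : Fin d → ℕ} (A : Tensor n) : Prop :=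
  A ≠ 0 ∧ IsLeast (normRatios (Set.univ : Set (Tensor n))) (tensorSpectralNorm A / ‖A‖)

/-- `A = Y₁ + ⋯ + Y_r` with pairwise orthogonal rank-one tensors `Y_l`. -/
def IsOrthogonalDecomposition {d : ℕ} {n : Fin d → ℕ} (A : Tensor n) (r : ℕ)
    (Y : Fin r → Tensor n) : Prop :=
  (∀ l, IsRankOne (Y l)) ∧ (∀ l m, l ≠ m → ⟪Y l, Y m⟫_ℝ = 0) ∧ A = ∑ l, Y l

/-- The orthogonal rank: the least length of a decomposition into pairwise orthogonal rank-one
tensors. (By `exists_isOrthogonalDecomposition` the infimum is over a nonempty set if `0 < d`.) -/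
noncomputable def orthogonalRank {d : ℕ} {n : Fin d → ℕ} (A : Tensor n) : ℕ :=
  sInf {r : ℕ | ∃ Y : Fin r → Tensor n, IsOrthogonalDecomposition A r Y}

theorem exists_isOrthogonalDecomposition {d : ℕ} {n : Fin d → ℕ} (hd : 0 < d) (A : Tensor n) :
    ∃ (r : ℕ) (Y : Fin r → Tensor n), IsOrthogonalDecomposition A r Y := by
  classical
  let s : Finset ((j : Fin d) → Fin (n j)) := Finset.univ.filter fun i => A i ≠ 0
  let e : Fin s.card ≃ s := s.equivFin.symm
  refine ⟨s.card, fun l => EuclideanSpace.single (e l : (j : Fin d) → Fin (n j)) (A (e l)),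
    ?_, ?_, ?_⟩
  · intro l
    have hl : A (e l) ≠ 0 := (Finset.mem_filter.1 (e l).2).2
    refine ⟨fun h => hl ?_, ?_⟩
    · have := congrArg (fun B : Tensor n => B (e l)) h
      simpa using this
    · refine ⟨fun j => EuclideanSpace.single ((e l : (j : Fin d) → Fin (n j)) j)
        (if j = ⟨0, hd⟩ then A (e l) else 1), ?_⟩
      ext i
      simp only [outerProduct, PiLp.single_apply]
      by_cases hi : i = (e l : (j : Fin d) → Fin (n j))
      · subst hi
        simp
      · obtain ⟨j, hj⟩ := Function.ne_iff.1 hi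
        rw [if_neg hi]
        symm
        apply Finset.prod_eq_zero (Finset.mem_univ j)
        simp [hj]
  · intro l m hlm
    have : (e l : (j : Fin d) → Fin (n j)) ≠ e m := fun h => hlm (e.injective (Subtype.ext h))
    simp [EuclideanSpace.inner_single_left, this]
  · ext i
    have h1 : (∑ l, EuclideanSpace.single (e l : (j : Fin d) → Fin (n j)) (A (e l)) : Tensor n)
        = ∑ k ∈ s, EuclideanSpace.single k (A k) := by
      rw [← Finset.sum_coe_sort s, ← e.sum_comp]
    rw [h1]
    simp [Finset.sum_apply, s]

/-- The largest orthogonal rank in a space of tensors of a given format. -/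
noncomputable def maxOrthogonalRank {d : ℕ} (n : Fin d → ℕ) : ℕ :=
  sSup (Set.range (orthogonalRank : Tensor n → ℕ))

/-- `Symᵈ(ℝⁿ)`: the tensors whose entries are invariant under permutations of the indices. -/
def symTensors (d n : ℕ) : Set (Tensor fun _ : Fin d => n) :=
  {A | ∀ (σ : Equiv.Perm (Fin d)) (i : Fin d → Fin n), A (fun j => i (σ j)) = A i}

/-- The form `p_A(x) = ∑ a_{i₁…i_d} x_{i₁} ⋯ x_{i_d}`. -/
noncomputable def formOfTensor {d n : ℕ} (A : Tensor fun _ : Fin d => n) :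
    MvPolynomial (Fin n) ℝ :=
  ∑ i : Fin d → Fin n, MvPolynomial.C (A i) * ∏ j, MvPolynomial.X (i j)

/-- The uniform norm: the maximum of `|p|` over the Euclidean unit sphere. -/
noncomputable def uniformNorm {n : ℕ} (p : MvPolynomial (Fin n) ℝ) : ℝ :=
  sSup {t : ℝ | ∃ x : EuclideanSpace ℝ (Fin n), ‖x‖ = 1 ∧ t = |MvPolynomial.eval (fun i => x i) p|}

/-- The Bombieri norm of a form: for `p = ∑_{|α| = d} c_α x^α` the square root of the sum of the
`c_α² / (d! / (α₁! ⋯ α_n!))`. -/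
noncomputable def bombieriNorm {n : ℕ} (p : MvPolynomial (Fin n) ℝ) : ℝ :=
  √(∑ α ∈ p.support, (α.multinomial : ℝ)⁻¹ * |p.coeff α| ^ 2)

/-- The conformal orthogonal group `CO(n) = ℝ₊ × O(n)`. -/
abbrev ConformalOrthogonalGroup (n : ℕ) : Type :=
  {s : ℝ // 0 < s} × Matrix.orthogonalGroup (Fin n) ℝ

/-- The action `(g^* p)(x) = s p(ρ⁻¹ x)` of `g = (s, ρ)` on polynomials. -/
noncomputable def conformalAction {n : ℕ} (g : ConformalOrthogonalGroup n)
    (p : MvPolynomial (Fin n) ℝ) : MvPolynomial (Fin n) ℝ :=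
  MvPolynomial.C (g.1 : ℝ) * MvPolynomial.bind₁ (fun i => ∑ j,
    MvPolynomial.C (((g.2⁻¹ : Matrix.orthogonalGroup (Fin n) ℝ) : Matrix (Fin n) (Fin n) ℝ) i j) *
      MvPolynomial.X j) p

/-- The ternary Chebyshev cubic `x₁³ - 3 x₁ (x₂² + x₃²)`. -/
noncomputable def chebyshevCubic : MvPolynomial (Fin 3) ℝ :=
  MvPolynomial.X 0 ^ 3 -
    3 * MvPolynomial.X 0 * (MvPolynomial.X 1 ^ 2 + MvPolynomial.X 2 ^ 2)

/-! Pairing `A` with an orthogonal decomposition into `r` rank-one terms and applying Cauchy–Schwarz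
gives `‖A‖ ≤ √r * tensorSpectralNorm A` (`IsOrthogonalDecomposition.norm_le`). Every ratio is
therefore at least `1 / √7` once orthogonal ranks are at most `7`.

For that bound (`orthogonalRank_le_seven`), write `A` in an orthonormal basis `u` of the first
factor. Each of the three slice combinations is a sum of three orthogonal terms, and a singular one
needs only two. The determinant is an odd function of the coefficient vector, so it vanishes at two
orthonormal vectors, and two of the nine terms disappear.

Sharpness comes from the form `4⟪v, x⟫³ - 3⟪v, x⟫‖x‖²` with `‖v‖ = 1`, which on the sphere is the
Chebyshev polynomial of degree three in `⟪v, x⟫` and so has uniform norm `1`. Its symmetric tensor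
has Frobenius norm `√7`, and by Banach's theorem its spectral norm is also `1`. The ratio is `1 /
√7`, and the first inequality then forces its orthogonal rank up to `7`.

The statements on forms are translations: the Bombieri norm is the Frobenius norm, the uniform norm
is the spectral norm, and `CO(3)` carries the cubic to positive multiples of forms of the same
shape. -/

section SpectralNorm

/-! ### Spectral norm and orthogonal decompositions. -/

variable {d : ℕ} {n : Fin d → ℕ}

theorem inner_eq_sum (A B : Tensor n) : ⟪A, B⟫_ℝ = ∑ i, A i * B i := by
  simp [PiLp.inner_apply, mul_comm]

theorem inner_outerProduct (x y : (j : Fin d) → EuclideanSpace ℝ (Fin (n j))) :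
    ⟪outerProduct x, outerProduct y⟫_ℝ = ∏ j, ⟪x j, y j⟫_ℝ := by
  have h (j : Fin d) : ⟪x j, y j⟫_ℝ = ∑ i, x j i * y j i := by
    simp [PiLp.inner_apply, mul_comm]
  simp_rw [inner_eq_sum, h, Fintype.prod_sum, outerProduct, Finset.prod_mul_distrib]

theorem norm_outerProduct (x : (j : Fin d) → EuclideanSpace ℝ (Fin (n j))) :
    ‖outerProduct x‖ = ∏ j, ‖x j‖ := by
  rw [← sq_eq_sq₀ (norm_nonneg _) (Finset.prod_nonneg fun _ _ => norm_nonneg _),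
    ← real_inner_self_eq_norm_sq, inner_outerProduct, ← Finset.prod_pow]
  simp_rw [real_inner_self_eq_norm_sq]

theorem outerProduct_smul (c : Fin d → ℝ) (x : (j : Fin d) → EuclideanSpace ℝ (Fin (n j))) :
    outerProduct (fun j => c j • x j) = (∏ j, c j) • outerProduct x := by
  ext i
  simp [outerProduct, Finset.prod_mul_distrib]

theorem bddAbove_inner_outerProduct (A : Tensor n) :
    BddAbove {t : ℝ | ∃ x : (j : Fin d) → EuclideanSpace ℝ (Fin (n j)),
      (∀ j, ‖x j‖ = 1) ∧ t = ⟪A, outerProduct x⟫_ℝ} := by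
  refine ⟨‖A‖, ?_⟩
  rintro _ ⟨x, hx, rfl⟩
  refine (real_inner_le_norm _ _).trans_eq ?_
  simp [norm_outerProduct, hx]

theorem inner_outerProduct_le_tensorSpectralNorm (A : Tensor n)
    {x : (j : Fin d) → EuclideanSpace ℝ (Fin (n j))} (hx : ∀ j, ‖x j‖ = 1) :
    ⟪A, outerProduct x⟫_ℝ ≤ tensorSpectralNorm A :=
  le_csSup (bddAbove_inner_outerProduct A) ⟨x, hx, rfl⟩

theorem IsRankOne.inner_le {Y : Tensor n} (hY : IsRankOne Y) (A : Tensor n) :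
    ⟪A, Y⟫_ℝ ≤ tensorSpectralNorm A * ‖Y‖ := by
  obtain ⟨h0, x, rfl⟩ := hY
  have hx (j : Fin d) : ‖x j‖ ≠ 0 := by
    intro hj
    apply h0
    rw [← norm_eq_zero, norm_outerProduct]
    exact Finset.prod_eq_zero (Finset.mem_univ j) hj
  have h1 := inner_outerProduct_le_tensorSpectralNorm A (x := fun j => ‖x j‖⁻¹ • x j)
    fun j => by simp [norm_smul, hx j]
  rw [outerProduct_smul, inner_smul_right, Finset.prod_inv_distrib, ← norm_outerProduct,
    inv_mul_le_iff₀ (norm_pos_iff.2 h0)] at h1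
  linarith

theorem IsOrthogonalDecomposition.norm_sq_eq {A : Tensor n} {r : ℕ} {Y : Fin r → Tensor n}
    (h : IsOrthogonalDecomposition A r Y) : ‖A‖ ^ 2 = ∑ l, ‖Y l‖ ^ 2 := by
  obtain ⟨-, ho, rfl⟩ := h
  rw [← real_inner_self_eq_norm_sq, sum_inner]
  refine Finset.sum_congr rfl fun l _ => ?_
  rw [inner_sum, Finset.sum_eq_single l (fun m _ hm => ho l m hm.symm) (by simp),
    real_inner_self_eq_norm_sq]

/-- A tensor with an orthogonal decomposition of length `r` has norm ratio at least `1 / √r`. -/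
theorem IsOrthogonalDecomposition.norm_le {A : Tensor n} {r : ℕ} {Y : Fin r → Tensor n}
    (h : IsOrthogonalDecomposition A r Y) (hA : A ≠ 0) : ‖A‖ ≤ √r * tensorSpectralNorm A := by
  have hpos : 0 < ‖A‖ := norm_pos_iff.2 hA
  have hsum : (∑ l, ‖Y l‖) ≤ √r * ‖A‖ := by
    have := sq_sum_le_card_mul_sum_sq (s := Finset.univ) (f := fun l => ‖Y l‖)
    rw [← h.norm_sq_eq, Finset.card_univ, Fintype.card_fin] at this
    refine Real.le_sqrt_of_sq_le this |>.trans_eq ?_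
    rw [Real.sqrt_mul (Nat.cast_nonneg r), Real.sqrt_sq hpos.le]
  have hle : ‖A‖ ^ 2 ≤ tensorSpectralNorm A * ∑ l, ‖Y l‖ := by
    rw [← real_inner_self_eq_norm_sq, Finset.mul_sum]
    nth_rw 2 [h.2.2]
    rw [inner_sum]
    exact Finset.sum_le_sum fun l _ => (h.1 l).inner_le A
  -- A negative value would make the right side of `hle` nonpositive, although `A ≠ 0`.
  have hS : 0 ≤ tensorSpectralNorm A := by
    have h0 : 0 ≤ ∑ l, ‖Y l‖ := Finset.sum_nonneg fun _ _ => norm_nonneg _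
    by_contra! hneg
    nlinarith [mul_nonneg (neg_nonneg.2 hneg.le) h0, pow_pos hpos 2]
  nlinarith [mul_le_mul_of_nonneg_left hsum hS]

end SpectralNorm

/-! ### Orthogonal rank of `(3,3,3)`-tensors is at most seven. -/

section OrthogonalRank

/-- Allows zero terms, which `IsRankOne` excludes: they are discarded, and `s` need only contain the
remaining ones. -/
theorem orthogonalRank_le {d : ℕ} {n : Fin d → ℕ} {ι : Type*} [Fintype ι] {Z : ι → Tensor n}
    (hZ : ∀ l, ∃ x : (j : Fin d) → EuclideanSpace ℝ (Fin (n j)), Z l = outerProduct x)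
    (ho : ∀ l m, l ≠ m → ⟪Z l, Z m⟫_ℝ = 0) {s : Finset ι} (hs : ∀ l ∉ s, Z l = 0) :
    orthogonalRank (∑ l, Z l) ≤ s.card := by
  classical
  set t := s.filter fun l => Z l ≠ 0 with ht
  refine (Nat.sInf_le ?_).trans (Finset.card_filter_le s fun l => Z l ≠ 0)
  let e : Fin t.card ≃ t := t.equivFin.symm
  refine ⟨fun l => Z (e l), fun l => ⟨(Finset.mem_filter.1 (e l).2).2, hZ _⟩,
    fun l m hlm => ho _ _ fun h => hlm (e.injective (Subtype.ext h)), ?_⟩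
  rw [e.sum_comp fun l => Z l, Finset.sum_coe_sort t Z]
  symm
  refine Finset.sum_subset (Finset.subset_univ t) fun l _ hl => ?_
  by_contra h
  exact hl (Finset.mem_filter.2 ⟨by_contra fun h' => h (hs l h'), h⟩)

/-- The half turn from `a` to `-a` changes the sign of `f`, so the intermediate value theorem
applies. -/
theorem exists_cos_sin_eq_zero {E : Type*} [NormedAddCommGroup E] [NormedSpace ℝ E] {f : E → ℝ}
    (hf : Continuous f) (hodd : ∀ x, f (-x) = -f x) (a b : E) :
    ∃ θ : ℝ, f (Real.cos θ • a + Real.sin θ • b) = 0 := by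
  set g : ℝ → ℝ := fun θ => f (Real.cos θ • a + Real.sin θ • b) with hg
  have hgc : Continuous g := by fun_prop
  have hpi : g Real.pi = -g 0 := by simp [hg, hodd]
  have hmem : (0 : ℝ) ∈ Set.uIcc (g 0) (g Real.pi) := by
    rw [hpi, Set.mem_uIcc]
    rcases le_total (g 0) 0 with h | h
    · exact Or.inl ⟨h, by linarith⟩
    · exact Or.inr ⟨by linarith, h⟩
  obtain ⟨θ, -, hθ⟩ := intermediate_value_uIcc hgc.continuousOn hmem
  exact ⟨θ, hθ⟩

theorem orthonormal_rotate {E : Type*} [NormedAddCommGroup E] [InnerProductSpace ℝ E] {a b : E}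
    (ha : ‖a‖ = 1) (hb : ‖b‖ = 1) (hab : ⟪a, b⟫_ℝ = 0) (θ : ℝ) :
    ‖Real.cos θ • a + Real.sin θ • b‖ = 1 := by
  rw [← sq_eq_sq₀ (norm_nonneg _) zero_le_one, norm_add_sq_real, norm_smul, norm_smul,
    real_inner_smul_left, real_inner_smul_right, hab, ha, hb]
  simp

/-- An odd continuous function on `ℝ³` vanishes at two orthogonal unit vectors. -/
theorem exists_orthonormal_zeros {f : EuclideanSpace ℝ (Fin 3) → ℝ} (hf : Continuous f)
    (hodd : ∀ x, f (-x) = -f x) :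
    ∃ u : OrthonormalBasis (Fin 3) ℝ (EuclideanSpace ℝ (Fin 3)), f (u 0) = 0 ∧ f (u 1) = 0 := by
  set e := EuclideanSpace.basisFun (Fin 3) ℝ
  have he (i j : Fin 3) : ⟪e i, e j⟫_ℝ = if i = j then 1 else 0 :=
    orthonormal_iff_ite.1 e.orthonormal i j
  obtain ⟨θ, hθ⟩ := exists_cos_sin_eq_zero hf hodd (e 0) (e 1)
  set a := Real.cos θ • e 0 + Real.sin θ • e 1
  set a' := -Real.sin θ • e 0 + Real.cos θ • e 1
  have ha : ‖a‖ = 1 := orthonormal_rotate (e.norm_eq_one 0) (e.norm_eq_one 1) (by simp [he]) θ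
  have ha' : ‖a'‖ = 1 := by
    have := orthonormal_rotate (e.norm_eq_one 0) (e.norm_eq_one 1) (by simp [he])
      (θ + Real.pi / 2)
    rwa [Real.cos_add_pi_div_two, Real.sin_add_pi_div_two] at this
  -- The span of `a'` and `e 2` is the orthogonal complement of `a`, so any zero found there is
  -- orthogonal to the first one.
  obtain ⟨φ, hφ⟩ := exists_cos_sin_eq_zero hf hodd a' (e 2)
  set b := Real.cos φ • a' + Real.sin φ • e 2
  have hb : ‖b‖ = 1 := orthonormal_rotate ha' (e.norm_eq_one 2)
    (by simp [a', inner_add_left, inner_smul_left, he]) φ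
  have hab : ⟪a, b⟫_ℝ = 0 := by
    simp [a, b, a', inner_add_left, inner_add_right, inner_smul_left, inner_smul_right, he]
    ring
  have hba : ⟪b, a⟫_ℝ = 0 := by rw [real_inner_comm, hab]
  obtain ⟨u, hu⟩ := Orthonormal.exists_orthonormalBasis_extension_of_card_eq (𝕜 := ℝ)
    (E := EuclideanSpace ℝ (Fin 3)) (ι := Fin 3) (by simp) (v := ![a, b, 0]) (s := {0, 1}) (by
      rw [orthonormal_iff_ite]
      rintro ⟨i, rfl | rfl⟩ ⟨j, rfl | rfl⟩ <;> simp [ha, hb, hab, hba, Subtype.ext_iff])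
  refine ⟨u, ?_, ?_⟩
  · rw [hu 0 (by simp)]; exact hθ
  · rw [hu 1 (by simp)]; exact hφ

theorem exists_orthonormalBasis_zero_eq {w : EuclideanSpace ℝ (Fin 3)} (hw : ‖w‖ = 1) :
    ∃ b : OrthonormalBasis (Fin 3) ℝ (EuclideanSpace ℝ (Fin 3)), b 0 = w := by
  obtain ⟨b, hb⟩ := Orthonormal.exists_orthonormalBasis_extension_of_card_eq (𝕜 := ℝ)
    (E := EuclideanSpace ℝ (Fin 3)) (ι := Fin 3) (by simp) (v := fun _ => w) (s := {0}) (by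
      rw [orthonormal_iff_ite]
      rintro ⟨i, rfl⟩ ⟨j, rfl⟩
      simp [hw])
  exact ⟨b, hb 0 rfl⟩

/-- The linear combination of the slices of `A` with coefficients `u`. -/
def sliceCombination (A : Tensor fun _ : Fin 3 => 3) (u : EuclideanSpace ℝ (Fin 3)) :
    Matrix (Fin 3) (Fin 3) ℝ :=
  Matrix.of fun b c => ∑ a, u a * A ![a, b, c]

/-- The contraction of `A` with `u` and `w` in the first two arguments. -/
def contraction (A : Tensor fun _ : Fin 3 => 3) (u w : EuclideanSpace ℝ (Fin 3)) :
    EuclideanSpace ℝ (Fin 3) :=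
  WithLp.toLp 2 (Matrix.vecMul w.ofLp (sliceCombination A u))

theorem OrthonormalBasis.sum_apply_mul_apply {ι κ : Type*} [Fintype ι] [Fintype κ]
    [DecidableEq κ] (b : OrthonormalBasis ι ℝ (EuclideanSpace ℝ κ)) (k l : κ) :
    ∑ i, b i k * b i l = if k = l then 1 else 0 := by
  have h := congrArg (fun v : EuclideanSpace ℝ κ => v k)
    (b.sum_repr' (EuclideanSpace.single l (1 : ℝ)))
  simpa [mul_comm, PiLp.single_apply, EuclideanSpace.inner_single_right] using h

/-- Two resolutions of the identity, in the first and the second index. The basis `w k` of the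
second factor may depend on `k`, so it can be adapted to the kernel of each slice combination. -/
theorem sum_outerProduct_contraction (A : Tensor fun _ : Fin 3 => 3)
    (u : OrthonormalBasis (Fin 3) ℝ (EuclideanSpace ℝ (Fin 3)))
    (w : Fin 3 → OrthonormalBasis (Fin 3) ℝ (EuclideanSpace ℝ (Fin 3))) :
    ∑ p : Fin 3 × Fin 3,
      (outerProduct ![u p.1, w p.1 p.2, contraction A (u p.1) (w p.1 p.2)] :
        Tensor fun _ : Fin 3 => 3) = A := by
  ext i
  have hi : i = ![i 0, i 1, i 2] := by ext j; fin_cases j <;> rfl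
  have h1 (k : Fin 3) : ∑ j, w k j (i 1) * contraction A (u k) (w k j) (i 2) =
      ∑ a, u k a * A ![a, i 1, i 2] := by
    calc _ = ∑ b, (∑ j, w k j (i 1) * w k j b) * ∑ a, u k a * A ![a, b, i 2] := by
          simp_rw [Finset.sum_mul]
          rw [Finset.sum_comm]
          simp [contraction, sliceCombination, Matrix.vecMul, dotProduct, Finset.mul_sum, mul_assoc]
      _ = _ := by simp [OrthonormalBasis.sum_apply_mul_apply]
  calc _ = ∑ k, u k (i 0) * ∑ j, w k j (i 1) * contraction A (u k) (w k j) (i 2) := by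
        simp [Fintype.sum_prod_type, outerProduct, Fin.prod_univ_three, Finset.mul_sum, mul_assoc]
    _ = ∑ a, (∑ k, u k (i 0) * u k a) * A ![a, i 1, i 2] := by
        simp_rw [h1, Finset.mul_sum, Finset.sum_mul]
        rw [Finset.sum_comm]
        simp [mul_assoc]
    _ = A i := by
        conv_rhs => rw [hi]
        simp [OrthonormalBasis.sum_apply_mul_apply]

theorem exists_contraction_eq_zero {A : Tensor fun _ : Fin 3 => 3}
    {u : EuclideanSpace ℝ (Fin 3)} (h : (sliceCombination A u).det = 0) :
    ∃ b : OrthonormalBasis (Fin 3) ℝ (EuclideanSpace ℝ (Fin 3)), contraction A u (b 0) = 0 := by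
  obtain ⟨v, hv, hv0⟩ := Matrix.exists_vecMul_eq_zero_iff.2 h
  have hv' : WithLp.toLp 2 v ≠ 0 := fun h => hv (by simpa using h)
  obtain ⟨b, hb⟩ := exists_orthonormalBasis_zero_eq
    (w := ‖WithLp.toLp 2 v‖⁻¹ • WithLp.toLp 2 v)
    (by simp [norm_smul, norm_ne_zero_iff.2 hv'])
  refine ⟨b, ?_⟩
  rw [hb, contraction, WithLp.ofLp_smul, Matrix.smul_vecMul, hv0]
  simp

/-- Two of the nine rank-one terms of a tensor can be made to vanish, because the determinant of
a combination of the slices vanishes for two orthogonal coefficient vectors. -/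
theorem orthogonalRank_le_seven (A : Tensor fun _ : Fin 3 => 3) : orthogonalRank A ≤ 7 := by
  obtain ⟨u, h0, h1⟩ := exists_orthonormal_zeros
    (f := fun u => (sliceCombination A u).det)
    (by
      refine Continuous.matrix_det (continuous_matrix fun b c => ?_)
      simp only [sliceCombination, Matrix.of_apply]
      fun_prop)
    (fun x => by
      have : sliceCombination A (-x) = -sliceCombination A x := by
        ext b c
        simp [sliceCombination]
      rw [this, Matrix.det_neg]
      simp [Odd.neg_one_pow (by decide : Odd 3)])
  obtain ⟨w0, hw0⟩ := exists_contraction_eq_zero h0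
  obtain ⟨w1, hw1⟩ := exists_contraction_eq_zero h1
  -- The third basis is arbitrary; `w0` is a filler.
  rw [← sum_outerProduct_contraction A u ![w0, w1, w0]]
  refine orthogonalRank_le (s := {(0, 0), (1, 0)}ᶜ) (fun l => ⟨_, rfl⟩) ?_ ?_
  · rintro ⟨k, j⟩ ⟨k', j'⟩ h
    rw [inner_outerProduct, Fin.prod_univ_three]
    -- Terms from one slice are orthogonal in the second factor, terms from different slices in the
    -- first.
    by_cases hk : k = k'
    · subst hk
      have hj : j ≠ j' := fun hj => h (by rw [hj])
      have := (![w0, w1, w0] k).orthonormal.2 hj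
      simp only [Matrix.cons_val_zero, Matrix.cons_val_one]
      rw [this]
      simp
    · have := u.orthonormal.2 hk
      simp only [Matrix.cons_val_zero]
      rw [this]
      simp
  · intro l hl
    rw [← norm_eq_zero, norm_outerProduct]
    refine Finset.prod_eq_zero (Finset.mem_univ 2) ?_
    rw [Finset.mem_compl, not_not, Finset.mem_insert, Finset.mem_singleton] at hl
    rcases hl with rfl | rfl
    · simpa using hw0
    · simpa using hw1

end OrthogonalRank

/-! ### Banach's theorem for symmetric trilinear forms. -/

section Banach

variable {E : Type*} [NormedAddCommGroup E] [InnerProductSpace ℝ E]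

/-- If a symmetric bilinear form attains its norm `l` at `(x, y)`, then also at the diagonal
vector `x + y`. -/
theorem bilin_add_self_eq (B : E →L[ℝ] E →L[ℝ] ℝ) (hB : ∀ x y, B x y = B y x) {l : ℝ}
    (hl : ∀ x, ‖x‖ = 1 → |B x x| ≤ l) {x y : E} (hx : ‖x‖ = 1) (hy : ‖y‖ = 1)
    (hxy : B x y = l) : B (x + y) (x + y) = l * ‖x + y‖ ^ 2 := by
  have hq (v : E) : |B v v| ≤ l * ‖v‖ ^ 2 := by
    by_cases hv : v = 0
    · simp [hv]
    · have hv' : 0 < ‖v‖ := norm_pos_iff.2 hv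
      have h := hl (‖v‖⁻¹ • v) (by simp [norm_smul, hv'.ne'])
      simp only [map_smul, smul_apply, smul_eq_mul] at h
      rw [← mul_assoc, abs_mul, abs_of_pos (by positivity : 0 < ‖v‖⁻¹ * ‖v‖⁻¹)] at h
      calc |B v v| = (‖v‖⁻¹ * ‖v‖⁻¹ * |B v v|) * ‖v‖ ^ 2 := by field_simp
        _ ≤ l * ‖v‖ ^ 2 := by gcongr
  -- Polarization: the bounds at `x + y` and `x - y` add up to `4 * l` by the parallelogram law, and
  -- `4 * l` is attained, so both are equalities.
  have h1 := le_of_abs_le (hq (x + y))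
  have h2 := neg_le_of_abs_le (hq (x - y))
  have h3 := parallelogram_law_with_norm ℝ x y
  have h4 : B (x + y) (x + y) - B (x - y) (x - y) = 4 * l := by
    simp only [map_add, map_sub, add_apply, sub_apply]
    rw [hB y x, hxy]
    ring
  have h5 : l * ‖x + y‖ ^ 2 + l * ‖x - y‖ ^ 2 = 4 * l := by
    rw [← mul_add, h3, hx, hy]
    ring
  linarith

/-- **Banach's theorem** for trilinear forms: a symmetric trilinear form on a finite-dimensional
Euclidean space attains its norm on the diagonal. -/
theorem exists_norm_attained_diagonal [FiniteDimensional ℝ E] [Nontrivial E]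
    (F : E →L[ℝ] E →L[ℝ] E →L[ℝ] ℝ) (h12 : ∀ x y z, F x y z = F y x z)
    (h23 : ∀ x y z, F x y z = F x z y) :
    ∃ w, ‖w‖ = 1 ∧ ∀ x y z, ‖x‖ = 1 → ‖y‖ = 1 → ‖z‖ = 1 → |F x y z| ≤ |F w w w| := by
  have : ProperSpace E := FiniteDimensional.proper_real E
  obtain ⟨e, he⟩ := exists_norm_eq E (zero_le_one (α := ℝ))
  have hS : IsCompact (Metric.sphere (0 : E) 1) := isCompact_sphere 0 1
  obtain ⟨⟨x, y, z⟩, hmem, hmax⟩ := (hS.prod (hS.prod hS)).exists_isMaxOn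
    ⟨(e, e, e), by simp [he]⟩
    (f := fun p : E × E × E => |F p.1 p.2.1 p.2.2|) (by fun_prop)
  simp only [Set.mem_prod, mem_sphere_zero_iff_norm] at hmem
  obtain ⟨hx, hy, hz⟩ := hmem
  set l := |F x y z| with hl
  have hle (a b c : E) (ha : ‖a‖ = 1) (hb : ‖b‖ = 1) (hc : ‖c‖ = 1) : |F a b c| ≤ l :=
    hmax (a := (a, b, c)) (by simp [ha, hb, hc])
  obtain ⟨x, hx, hxl⟩ : ∃ x, ‖x‖ = 1 ∧ F x y z = l := by
    rcases abs_choice (F x y z) with h | h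
    · exact ⟨x, hx, by rw [hl, h]⟩
    · exact ⟨-x, by rwa [norm_neg], by rw [hl, h]; simp⟩
  -- a diagonal pair from an arbitrary one
  have hdiag (a b c : E) (ha : ‖a‖ = 1) (hb : ‖b‖ = 1) (hc : ‖c‖ = 1) (h : F a b c = l)
      (hab : a + b ≠ 0) : F c (‖a + b‖⁻¹ • (a + b)) (‖a + b‖⁻¹ • (a + b)) = l := by
    have h' : F c a b = l := by rw [h12, h23, h]
    have h1 := bilin_add_self_eq (F c) (h23 c) (fun v hv => hle c v v hc hv hv) ha hb h'
    have : ‖a + b‖ ≠ 0 := norm_ne_zero_iff.2 hab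
    rw [map_smul, map_smul, smul_apply, h1, smul_eq_mul, smul_eq_mul]
    field_simp
  have hunit (v : E) (hv : v ≠ 0) : ‖‖v‖⁻¹ • v‖ = 1 := by
    simp [norm_smul, norm_ne_zero_iff.2 hv]
  -- Among the maximizers of the form `(z, w, w)`, one with `⟪w, z⟫` as large as possible is chosen;
  -- it turns out to satisfy `z = w` or `z = -w`.
  set P : Set (E × E) :=
    (Metric.sphere (0 : E) 1 ×ˢ Metric.sphere (0 : E) 1) ∩ {p | F p.2 p.1 p.1 = l} with hP
  have hPc : IsCompact P := (hS.prod hS).inter_right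
    (isClosed_eq (by fun_prop) continuous_const)
  have hPne : P.Nonempty := by
    by_cases hxy : x + y = 0
    · refine ⟨(x, -z), by simp [hx, hz], ?_⟩
      obtain rfl : y = -x := (neg_eq_of_add_eq_zero_right hxy).symm
      change F (-z) x x = l
      rw [← hxl, h12, h23]
      simp
    · exact ⟨(‖x + y‖⁻¹ • (x + y), z), by simpa [hz] using hunit _ hxy,
        hdiag x y z hx hy hz hxl hxy⟩
  obtain ⟨⟨w, z⟩, ⟨hwz, hwzl⟩, hmax'⟩ := hPc.exists_isMaxOn hPne
    (f := fun p : E × E => ⟪p.1, p.2⟫_ℝ) (by fun_prop)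
  simp only [Set.mem_prod, mem_sphere_zero_iff_norm] at hwz
  obtain ⟨hw, hz⟩ := hwz
  replace hwzl : F z w w = l := hwzl
  refine ⟨w, hw, fun a b c ha hb hc => (hle a b c ha hb hc).trans ?_⟩
  by_cases h0 : w + z = 0
  · obtain rfl : z = -w := (neg_eq_of_add_eq_zero_right h0).symm
    rw [← hwzl]
    simpa using neg_le_abs (F w w w)
  · have hv := hunit _ h0
    -- Diagonalizing the pair `w, z` gives another element of `P`, namely the normalized `w + z`
    -- paired with `w`. Maximality then bounds its inner product by `⟪w, z⟫`.
    have h1 := hdiag w z w hw hz hw ((h12 w z w).trans hwzl) h0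
    have h2 : ⟪‖w + z‖⁻¹ • (w + z), w⟫_ℝ ≤ ⟪w, z⟫_ℝ :=
      hmax' (a := (‖w + z‖⁻¹ • (w + z), w)) ⟨by simpa [hw] using hv, h1⟩
    have hn : ‖w + z‖ ^ 2 = 2 + 2 * ⟪w, z⟫_ℝ := by
      rw [norm_add_sq_real, hw, hz]; ring
    have hpos : 0 < ‖w + z‖ := norm_pos_iff.2 h0
    rw [real_inner_smul_left, inner_add_left, real_inner_self_eq_norm_sq, hw,
      real_inner_comm w z, inv_mul_le_iff₀ hpos] at h2
    set t := ⟪w, z⟫_ℝ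
    -- `h2` says `1 + t ≤ ‖w + z‖ * t`. Squaring and cancelling `1 + t` gives `1 + t ≤ 2 * t ^ 2`,
    -- that is `(2 * t + 1) * (t - 1) ≥ 0`.
    have ht : 1 ≤ t := by
      have h1t : 0 < 1 + t := by nlinarith
      have htpos : 0 < t := by
        by_contra! hneg
        nlinarith
      have : (1 + t) ^ 2 ≤ (2 + 2 * t) * t ^ 2 := by
        rw [← hn, ← mul_pow]
        exact pow_le_pow_left₀ (by linarith) (by linarith) 2
      nlinarith
    have ht' : t = 1 := le_antisymm (by simpa [hw, hz] using real_inner_le_norm w z) ht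
    obtain rfl : w = z := (inner_eq_one_iff_of_norm_eq_one hw hz).1 ht'
    rw [← hwzl]
    exact le_abs_self _

end Banach

/-! ### Symmetric tensors and forms. -/

section Forms

variable {d n : ℕ}

/-- The exponent of the monomial `x_{i₁} ⋯ x_{i_d}`. -/
noncomputable def indexDegree (i : Fin d → Fin n) : Fin n →₀ ℕ :=
  ∑ j, Finsupp.single (i j) 1

theorem prod_X_eq_monomial (i : Fin d → Fin n) :
    ∏ j, (MvPolynomial.X (i j) : MvPolynomial (Fin n) ℝ) =
      MvPolynomial.monomial (indexDegree i) 1 := by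
  rw [indexDegree, MvPolynomial.monomial_sum_one]
  rfl

theorem degree_indexDegree (i : Fin d → Fin n) : (indexDegree i).degree = d := by
  simp [indexDegree, map_sum]

theorem indexDegree_comp_perm (i : Fin d → Fin n) (σ : Equiv.Perm (Fin d)) :
    indexDegree (fun j => i (σ j)) = indexDegree i :=
  Equiv.sum_comp σ fun j => Finsupp.single (i j) 1

theorem indexDegree_apply (i : Fin d → Fin n) (a : Fin n) :
    indexDegree i a = Fintype.card {j // i j = a} := by
  simp [indexDegree, Finsupp.finsetSum_apply, Finsupp.single_apply, Fintype.card_subtype]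

/-- The fibres of `i` and `k` have equal sizes, so fibrewise bijections glue to a permutation. -/
theorem exists_perm_of_indexDegree_eq {i k : Fin d → Fin n}
    (h : indexDegree i = indexDegree k) : ∃ σ : Equiv.Perm (Fin d), (fun j => i (σ j)) = k := by
  have e (a : Fin n) : {j // k j = a} ≃ {j // i j = a} :=
    Fintype.equivOfCardEq (by rw [← indexDegree_apply, ← indexDegree_apply, h])
  exact ⟨Equiv.ofFiberEquiv e, funext fun j => Equiv.ofFiberEquiv_map e j⟩

theorem coeff_formOfTensor (A : Tensor fun _ : Fin d => n) (α : Fin n →₀ ℕ) :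
    (formOfTensor A).coeff α = ∑ i with indexDegree i = α, A i := by
  simp [formOfTensor, MvPolynomial.coeff_sum, prod_X_eq_monomial, MvPolynomial.coeff_C_mul,
    MvPolynomial.coeff_monomial, Finset.sum_filter]

/-- Compares the coefficients of `x^α` in two expansions of `(∑ X a) ^ d`: by words and by the
multinomial theorem. -/
theorem card_indexDegree_eq {α : Fin n →₀ ℕ} (hα : α.degree = d) :
    (Finset.univ.filter fun i : Fin d → Fin n => indexDegree i = α).card = α.multinomial := by
  have h1 : (∑ a : Fin n, (MvPolynomial.X a : MvPolynomial (Fin n) ℝ)) ^ d =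
      ∑ i : Fin d → Fin n, MvPolynomial.monomial (indexDegree i) 1 := by
    simp_rw [← prod_X_eq_monomial]
    rw [← Fintype.prod_sum (fun (_ : Fin d) (a : Fin n) => MvPolynomial.X a)]
    simp
  have h2 : (∑ a : Fin n, (MvPolynomial.X a : MvPolynomial (Fin n) ℝ)) ^ d =
      ∑ k ∈ Finset.piAntidiag Finset.univ d,
        MvPolynomial.monomial (Finsupp.equivFunOnFinite.symm k)
          (Nat.multinomial Finset.univ k : ℝ) := by
    rw [Finset.sum_pow_eq_sum_piAntidiag]
    refine Finset.sum_congr rfl fun k _ => ?_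
    rw [MvPolynomial.monomial_eq, Finsupp.prod_fintype _ _ (by simp)]
    simp
  have h3 := congrArg (MvPolynomial.coeff α) (h1.symm.trans h2)
  rw [MvPolynomial.coeff_sum, MvPolynomial.coeff_sum] at h3
  simp only [MvPolynomial.coeff_monomial] at h3
  rw [Finset.sum_boole, Finset.sum_eq_single (α : Fin n → ℕ)] at h3
  · rw [if_pos (by ext; simp), Finsupp.multinomial_of_support_subset (Finset.subset_univ _)] at h3
    exact_mod_cast h3
  · intro k _ hk
    rw [if_neg]
    rintro rfl
    exact hk (by ext; simp)
  · intro hα'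
    refine absurd (Finset.mem_piAntidiag.2 ⟨?_, by simp⟩) hα'
    rw [← hα, Finsupp.degree_eq_sum]

theorem isHomogeneous_formOfTensor (A : Tensor fun _ : Fin d => n) :
    (formOfTensor A).IsHomogeneous d := by
  refine MvPolynomial.IsHomogeneous.sum _ _ _ fun i _ => ?_
  rw [prod_X_eq_monomial, MvPolynomial.C_mul_monomial, mul_one]
  exact MvPolynomial.isHomogeneous_monomial _ (degree_indexDegree i)

theorem multinomial_ne_zero (α : Fin n →₀ ℕ) : (α.multinomial : ℝ) ≠ 0 := by
  rw [Finsupp.multinomial_eq]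
  exact_mod_cast (Nat.multinomial_pos _ _).ne'

theorem coeff_formOfTensor_indexDegree {A : Tensor fun _ : Fin d => n} (hA : A ∈ symTensors d n)
    (i : Fin d → Fin n) :
    (formOfTensor A).coeff (indexDegree i) = (indexDegree i).multinomial * A i := by
  rw [coeff_formOfTensor, Finset.sum_congr rfl (g := fun _ => A i),
    Finset.sum_const, card_indexDegree_eq (degree_indexDegree i), nsmul_eq_mul]
  intro k hk
  obtain ⟨σ, rfl⟩ := exists_perm_of_indexDegree_eq (Finset.mem_filter.1 hk).2
  exact (hA σ k).symm

theorem formOfTensor_injOn : Set.InjOn formOfTensor (symTensors d n) := by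
  intro A hA B hB h
  ext i
  have := coeff_formOfTensor_indexDegree hA i
  rw [h, coeff_formOfTensor_indexDegree hB i] at this
  exact (mul_left_cancel₀ (multinomial_ne_zero _) this).symm

/-- Every form of degree `d` corresponds to a symmetric tensor. -/
theorem exists_symTensor_formOfTensor_eq {p : MvPolynomial (Fin n) ℝ} (hp : p.IsHomogeneous d) :
    ∃ A ∈ symTensors d n, formOfTensor A = p := by
  refine ⟨WithLp.toLp 2 fun i =>
    ((indexDegree i).multinomial : ℝ)⁻¹ * p.coeff (indexDegree i), ?_, ?_⟩
  · intro σ i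
    simp [indexDegree_comp_perm]
  · ext α
    by_cases hα : α.degree = d
    · rw [coeff_formOfTensor, Finset.sum_congr rfl
        (g := fun _ => (α.multinomial : ℝ)⁻¹ * p.coeff α), Finset.sum_const,
        card_indexDegree_eq hα, nsmul_eq_mul, mul_inv_cancel_left₀ (multinomial_ne_zero α)]
      intro i hi
      simp [(Finset.mem_filter.1 hi).2]
    · rw [hp.coeff_eq_zero hα, (isHomogeneous_formOfTensor _).coeff_eq_zero hα]

/-- The entries belonging to `x^α` are `α.multinomial` equal numbers `c_α / α.multinomial`; their
squares add up to the Bombieri weight. -/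
theorem bombieriNorm_formOfTensor {A : Tensor fun _ : Fin d => n} (hA : A ∈ symTensors d n) :
    bombieriNorm (formOfTensor A) = ‖A‖ := by
  rw [EuclideanSpace.norm_eq, bombieriNorm]
  congr 1
  have h0 : ∀ i ∈ Finset.univ.filter fun i => A i ≠ 0,
      indexDegree i ∈ (formOfTensor A).support := fun i hi => by
    rw [MvPolynomial.mem_support_iff, coeff_formOfTensor_indexDegree hA]
    exact mul_ne_zero (multinomial_ne_zero _) (Finset.mem_filter.1 hi).2
  calc _ = ∑ α ∈ (formOfTensor A).support, ∑ i with indexDegree i = α, ‖A i‖ ^ 2 := by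
        refine Finset.sum_congr rfl fun α hα => ?_
        have hd : α.degree = d := by
          by_contra h
          exact MvPolynomial.mem_support_iff.1 hα
            ((isHomogeneous_formOfTensor A).coeff_eq_zero h)
        rw [Finset.sum_congr rfl
          (g := fun _ => ((α.multinomial : ℝ)⁻¹ * |(formOfTensor A).coeff α|) ^ 2),
          Finset.sum_const, card_indexDegree_eq hd, nsmul_eq_mul]
        · have := multinomial_ne_zero α
          field_simp
        · intro i hi
          obtain rfl := (Finset.mem_filter.1 hi).2
          rw [coeff_formOfTensor_indexDegree hA, abs_mul, Nat.abs_cast,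
            inv_mul_cancel_left₀ (multinomial_ne_zero _), Real.norm_eq_abs]
    -- Only for nonzero entries does `indexDegree` land in the support, as the fibrewise summation
    -- requires.
    _ = ∑ α ∈ (formOfTensor A).support,
          ∑ i ∈ Finset.univ.filter (fun i => A i ≠ 0) with indexDegree i = α, ‖A i‖ ^ 2 := by
        refine Finset.sum_congr rfl fun α _ => ?_
        refine (Finset.sum_subset (Finset.filter_subset_filter _ (Finset.filter_subset _ _))
          fun i hi hi' => ?_).symm
        have : A i = 0 := by
          by_contra h
          simp_all
        simp [this]
    _ = ∑ i with A i ≠ 0, ‖A i‖ ^ 2 := Finset.sum_fiberwise_of_maps_to h0 _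
    _ = _ := by
        refine Finset.sum_subset (Finset.filter_subset _ _) fun i _ hi' => ?_
        have : A i = 0 := by
          by_contra h
          simp_all
        simp [this]

theorem eval_formOfTensor (A : Tensor fun _ : Fin d => n) (x : EuclideanSpace ℝ (Fin n)) :
    MvPolynomial.eval (fun i => x i) (formOfTensor A) = ⟪A, outerProduct fun _ => x⟫_ℝ := by
  simp [formOfTensor, inner_eq_sum, outerProduct]

set_option maxSynthPendingDepth 3 in
/-- The trilinear form of a tensor of order three. -/
noncomputable def trilinearForm (A : Tensor fun _ : Fin 3 => n) :
    EuclideanSpace ℝ (Fin n) →L[ℝ] EuclideanSpace ℝ (Fin n) →L[ℝ]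
      EuclideanSpace ℝ (Fin n) →L[ℝ] ℝ :=
  ∑ i, A i • (EuclideanSpace.proj (i 0) : EuclideanSpace ℝ (Fin n) →L[ℝ] ℝ).smulRight
    ((EuclideanSpace.proj (i 1) : EuclideanSpace ℝ (Fin n) →L[ℝ] ℝ).smulRight
      (EuclideanSpace.proj (i 2) : EuclideanSpace ℝ (Fin n) →L[ℝ] ℝ))

set_option maxSynthPendingDepth 3 in
theorem trilinearForm_apply (A : Tensor fun _ : Fin 3 => n)
    (x : (j : Fin 3) → EuclideanSpace ℝ (Fin n)) :
    trilinearForm A (x 0) (x 1) (x 2) = ⟪A, outerProduct x⟫_ℝ := by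
  simp [trilinearForm, inner_eq_sum, outerProduct, Fin.prod_univ_three, mul_assoc]

theorem inner_outerProduct_comp_perm {A : Tensor fun _ : Fin d => n} (hA : A ∈ symTensors d n)
    (σ : Equiv.Perm (Fin d)) (x : (j : Fin d) → EuclideanSpace ℝ (Fin n)) :
    ⟪A, outerProduct fun j => x (σ j)⟫_ℝ = ⟪A, outerProduct x⟫_ℝ := by
  rw [inner_eq_sum, inner_eq_sum]
  refine Fintype.sum_equiv (Equiv.arrowCongr σ (Equiv.refl _)) _ _ fun i => ?_
  have h1 := hA σ.symm i
  rw [show (Equiv.arrowCongr σ (Equiv.refl (Fin n))) i = fun j => i (σ.symm j) from rfl, h1]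
  congr 1
  exact (Fintype.prod_equiv σ _ _ fun j => by simp)

theorem abs_inner_outerProduct_le_tensorSpectralNorm [NeZero d] (A : Tensor fun _ : Fin d => n)
    {x : (j : Fin d) → EuclideanSpace ℝ (Fin n)} (hx : ∀ j, ‖x j‖ = 1) :
    |⟪A, outerProduct x⟫_ℝ| ≤ tensorSpectralNorm A := by
  refine abs_le'.2 ⟨inner_outerProduct_le_tensorSpectralNorm A hx, ?_⟩
  -- Negating a single factor changes the sign of the outer product.
  have h := outerProduct_smul (fun j : Fin d => if j = 0 then (-1 : ℝ) else 1) x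
  rw [Finset.prod_ite_eq' Finset.univ (0 : Fin d), if_pos (Finset.mem_univ _), neg_one_smul] at h
  rw [← inner_neg_right, ← h]
  refine inner_outerProduct_le_tensorSpectralNorm A fun j => ?_
  split_ifs <;> simp [hx]

/-- The spectral norm of a symmetric tensor of order three is the uniform norm of its form. -/
theorem tensorSpectralNorm_eq_uniformNorm [NeZero n] {A : Tensor fun _ : Fin 3 => n}
    (hA : A ∈ symTensors 3 n) : tensorSpectralNorm A = uniformNorm (formOfTensor A) := by
  have : Nontrivial (EuclideanSpace ℝ (Fin n)) :=
    ⟨EuclideanSpace.single 0 1, 0, fun h => by simpa using congrArg (fun v => v 0) h⟩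
  have h12 (x y z : EuclideanSpace ℝ (Fin n)) :
      trilinearForm A x y z = trilinearForm A y x z := by
    have := inner_outerProduct_comp_perm hA (Equiv.swap 0 1) ![x, y, z]
    rw [← trilinearForm_apply, ← trilinearForm_apply] at this
    simpa [Equiv.swap_apply_of_ne_of_ne] using this.symm
  have h23 (x y z : EuclideanSpace ℝ (Fin n)) :
      trilinearForm A x y z = trilinearForm A x z y := by
    have := inner_outerProduct_comp_perm hA (Equiv.swap 1 2) ![x, y, z]
    rw [← trilinearForm_apply, ← trilinearForm_apply] at this
    simpa [Equiv.swap_apply_of_ne_of_ne] using this.symm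
  obtain ⟨w, hw, hmax⟩ := exists_norm_attained_diagonal (trilinearForm A) h12 h23
  have hbdd (x : EuclideanSpace ℝ (Fin n)) (hx : ‖x‖ = 1) :
      |MvPolynomial.eval (fun i => x i) (formOfTensor A)| ≤ tensorSpectralNorm A := by
    rw [eval_formOfTensor]
    exact abs_inner_outerProduct_le_tensorSpectralNorm A fun _ => hx
  apply le_antisymm
  · refine csSup_le ⟨_, fun _ => w, fun _ => hw, rfl⟩ ?_
    rintro _ ⟨x, hx, rfl⟩
    rw [← trilinearForm_apply]
    refine (le_abs_self _).trans ((hmax _ _ _ (hx 0) (hx 1) (hx 2)).trans ?_)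
    refine le_csSup ⟨tensorSpectralNorm A, ?_⟩ ⟨w, hw, ?_⟩
    · rintro _ ⟨x, hx, rfl⟩
      exact hbdd x hx
    · rw [eval_formOfTensor, ← trilinearForm_apply]
  · refine csSup_le ⟨_, w, hw, rfl⟩ ?_
    rintro _ ⟨x, hx, rfl⟩
    exact hbdd x hx

end Forms

/-! ### The Chebyshev tensor and its orbit. -/

section Chebyshev

theorem sum_fin_three_arrow {M : Type*} [AddCommMonoid M] {κ : Type*} [Fintype κ]
    (f : (Fin 3 → κ) → M) : ∑ i, f i = ∑ a, ∑ b, ∑ c, f ![a, b, c] := by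
  rw [← (Fin.consEquiv fun _ : Fin 3 => κ).sum_comp, Fintype.sum_prod_type]
  refine Finset.sum_congr rfl fun a _ => ?_
  rw [← (finTwoArrowEquiv κ).symm.sum_comp, Fintype.sum_prod_type]
  rfl

/-- The symmetric tensor of the cubic form `4 ⟪v, x⟫³ - 3 ⟪v, x⟫ ‖x‖²`. -/
noncomputable def chebyshevTensor (v : EuclideanSpace ℝ (Fin 3)) : Tensor fun _ : Fin 3 => 3 :=
  WithLp.toLp 2 fun i => 4 * (v (i 0) * v (i 1) * v (i 2)) -
    ((if i 1 = i 2 then v (i 0) else 0) + (if i 0 = i 2 then v (i 1) else 0) +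
      (if i 0 = i 1 then v (i 2) else 0))

theorem chebyshevTensor_mem_symTensors (v : EuclideanSpace ℝ (Fin 3)) :
    chebyshevTensor v ∈ symTensors 3 3 := by
  intro σ i
  have h : ∀ σ : Equiv.Perm (Fin 3), (σ 0 = 0 ∧ σ 1 = 1 ∧ σ 2 = 2) ∨
      (σ 0 = 0 ∧ σ 1 = 2 ∧ σ 2 = 1) ∨ (σ 0 = 1 ∧ σ 1 = 0 ∧ σ 2 = 2) ∨
      (σ 0 = 1 ∧ σ 1 = 2 ∧ σ 2 = 0) ∨ (σ 0 = 2 ∧ σ 1 = 0 ∧ σ 2 = 1) ∨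
      (σ 0 = 2 ∧ σ 1 = 1 ∧ σ 2 = 0) := by decide
  rcases h σ with ⟨h0, h1, h2⟩ | ⟨h0, h1, h2⟩ | ⟨h0, h1, h2⟩ | ⟨h0, h1, h2⟩ | ⟨h0, h1, h2⟩ |
    ⟨h0, h1, h2⟩ <;>
  · simp only [chebyshevTensor, h0, h1, h2, eq_comm (a := i 1) (b := i 0),
      eq_comm (a := i 2) (b := i 0), eq_comm (a := i 2) (b := i 1)]
    try ring

theorem norm_sq_eq_fin_three (v : EuclideanSpace ℝ (Fin 3)) :
    ‖v‖ ^ 2 = v 0 ^ 2 + v 1 ^ 2 + v 2 ^ 2 := by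
  simp [EuclideanSpace.norm_sq_eq, Fin.sum_univ_three]

theorem norm_chebyshevTensor {v : EuclideanSpace ℝ (Fin 3)} (hv : ‖v‖ = 1) :
    ‖chebyshevTensor v‖ = √7 := by
  -- At `‖v‖ = 1` this is `16 - 24 + 15 = 7`.
  have h : ‖chebyshevTensor v‖ ^ 2 =
      16 * (‖v‖ ^ 2) ^ 3 - 24 * (‖v‖ ^ 2) ^ 2 + 15 * ‖v‖ ^ 2 := by
    rw [norm_sq_eq_fin_three, EuclideanSpace.norm_sq_eq]
    rw [sum_fin_three_arrow]
    simp [chebyshevTensor, Fin.sum_univ_three]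
    ring
  rw [hv] at h
  rw [← Real.sqrt_sq (norm_nonneg (chebyshevTensor v)), h]
  norm_num

theorem inner_chebyshevTensor (v x : EuclideanSpace ℝ (Fin 3)) :
    ⟪chebyshevTensor v, outerProduct fun _ => x⟫_ℝ =
      4 * ⟪v, x⟫_ℝ ^ 3 - 3 * ⟪v, x⟫_ℝ * ‖x‖ ^ 2 := by
  rw [inner_eq_sum, sum_fin_three_arrow, norm_sq_eq_fin_three]
  simp [chebyshevTensor, outerProduct, Fin.sum_univ_three, Fin.prod_univ_three,
    PiLp.inner_apply]
  ring

/-- Rests on `1 ± (4t³ - 3t) = (1 ± t)(2t ∓ 1)²`. -/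
theorem abs_chebyshev_three_le {t : ℝ} (ht : |t| ≤ 1) : |4 * t ^ 3 - 3 * t| ≤ 1 := by
  obtain ⟨h1, h2⟩ := abs_le.1 ht
  rw [abs_le]
  constructor
  · nlinarith [mul_nonneg (by linarith : 0 ≤ t + 1) (sq_nonneg (2 * t - 1))]
  · nlinarith [mul_nonneg (by linarith : 0 ≤ 1 - t) (sq_nonneg (2 * t + 1))]

theorem smul_mem_symTensors {d n : ℕ} (s : ℝ) {A : Tensor fun _ : Fin d => n}
    (hA : A ∈ symTensors d n) : s • A ∈ symTensors d n := fun σ i => by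
  simpa using Or.inl (hA σ i)

theorem uniformNorm_chebyshevTensor {v : EuclideanSpace ℝ (Fin 3)} (hv : ‖v‖ = 1) {s : ℝ}
    (hs : 0 < s) : uniformNorm (formOfTensor (s • chebyshevTensor v)) = s := by
  refine IsGreatest.csSup_eq ⟨⟨v, hv, ?_⟩, ?_⟩
  · rw [eval_formOfTensor, real_inner_smul_left, inner_chebyshevTensor,
      real_inner_self_eq_norm_sq, hv]
    norm_num [abs_of_pos hs]
  · rintro _ ⟨x, hx, rfl⟩
    rw [eval_formOfTensor, real_inner_smul_left, inner_chebyshevTensor, hx, one_pow, mul_one,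
      abs_mul, abs_of_pos hs]
    refine mul_le_of_le_one_right hs.le (abs_chebyshev_three_le ?_)
    simpa [hv, hx] using abs_real_inner_le_norm v x

theorem tensorSpectralNorm_chebyshevTensor {v : EuclideanSpace ℝ (Fin 3)} (hv : ‖v‖ = 1) :
    tensorSpectralNorm (chebyshevTensor v) = 1 := by
  rw [tensorSpectralNorm_eq_uniformNorm (chebyshevTensor_mem_symTensors v)]
  simpa using uniformNorm_chebyshevTensor hv one_pos

theorem chebyshevTensor_ne_zero {v : EuclideanSpace ℝ (Fin 3)} (hv : ‖v‖ = 1) :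
    chebyshevTensor v ≠ 0 := by
  rw [← norm_ne_zero_iff, norm_chebyshevTensor hv]
  positivity

/-- The forms in the orbit of the Chebyshev cubic under the conformal orthogonal group. -/
theorem exists_conformalAction_chebyshevCubic (g : ConformalOrthogonalGroup 3) :
    ∃ v : EuclideanSpace ℝ (Fin 3), ‖v‖ = 1 ∧
      conformalAction g chebyshevCubic = formOfTensor ((g.1 : ℝ) • chebyshevTensor v) := by
  obtain ⟨s, ρ⟩ := g
  set R : Matrix (Fin 3) (Fin 3) ℝ :=
    ((ρ⁻¹ : Matrix.orthogonalGroup (Fin 3) ℝ) : Matrix (Fin 3) (Fin 3) ℝ) with hR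
  have h1 : R * R.transpose = 1 := (Matrix.mem_orthogonalGroup_iff (Fin 3) ℝ).1 (ρ⁻¹).2
  have h2 : R.transpose * R = 1 := (Matrix.mem_orthogonalGroup_iff' (Fin 3) ℝ).1 (ρ⁻¹).2
  -- The cubic is `4x₁³ - 3x₁‖x‖²`. Since `R` preserves the norm, substituting `R x` only replaces
  -- `x₁` by the inner product with row `0` of `R`.
  refine ⟨WithLp.toLp 2 (R 0), ?_, ?_⟩
  · rw [← sq_eq_sq₀ (norm_nonneg _) zero_le_one, norm_sq_eq_fin_three]
    have := congrFun (congrFun h1 0) 0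
    simp [Matrix.mul_apply, Fin.sum_univ_three] at this
    linarith
  · refine MvPolynomial.funext fun x => ?_
    have h3 := eval_formOfTensor ((s : ℝ) • chebyshevTensor (WithLp.toLp 2 (R 0)))
      (WithLp.toLp 2 x)
    rw [real_inner_smul_left, inner_chebyshevTensor, norm_sq_eq_fin_three] at h3
    simp only at h3
    rw [h3]
    have h4 (a b : Fin 3) := congrFun (congrFun h2 a) b
    simp only [Matrix.mul_apply, Fin.sum_univ_three, Matrix.transpose_apply] at h4
    have h00 := h4 0 0
    have h11 := h4 1 1
    have h22 := h4 2 2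
    have h01 := h4 0 1
    have h02 := h4 0 2
    have h12 := h4 1 2
    simp at h00 h11 h22 h01 h02 h12
    have h5 (f : Fin 3 → MvPolynomial (Fin 3) ℝ) : MvPolynomial.bind₁ f 3 = 3 :=
      map_ofNat (MvPolynomial.bind₁ f) 3
    simp only [conformalAction, chebyshevCubic, ← hR]
    simp [Fin.sum_univ_three, PiLp.inner_apply, h5]
    left
    -- The difference of the two sides is `-3 (R x)₁ (‖R x‖² - ‖x‖²)`, expanded through the entries
    -- of `Rᵀ R = 1`.
    linear_combination (-3 * (R 0 0 * x 0 + R 0 1 * x 1 + R 0 2 * x 2)) *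
      (x 0 ^ 2 * h00 + x 1 ^ 2 * h11 + x 2 ^ 2 * h22 + 2 * x 0 * x 1 * h01 +
        2 * x 0 * x 2 * h02 + 2 * x 1 * x 2 * h12)

theorem conformalAction_one {n : ℕ} (p : MvPolynomial (Fin n) ℝ) :
    conformalAction (⟨1, one_pos⟩, 1) p = p := by
  have : (fun i : Fin n => ∑ j, MvPolynomial.C ((1 : Matrix (Fin n) (Fin n) ℝ) i j) *
      (MvPolynomial.X j : MvPolynomial (Fin n) ℝ)) = MvPolynomial.X := by
    ext1 i
    simp [Matrix.one_apply, apply_ite]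
  simp [conformalAction, this]

theorem exists_formOfTensor_chebyshevTensor :
    ∃ v : EuclideanSpace ℝ (Fin 3), ‖v‖ = 1 ∧
      formOfTensor (chebyshevTensor v) = chebyshevCubic := by
  obtain ⟨v, hv, h⟩ := exists_conformalAction_chebyshevCubic (⟨1, one_pos⟩, 1)
  rw [conformalAction_one, one_smul] at h
  exact ⟨v, hv, h.symm⟩

end Chebyshev

/-! ### Combining the bounds. -/

section Extremal

theorem exists_isOrthogonalDecomposition_orthogonalRank (A : Tensor fun _ : Fin 3 => 3) :
    ∃ Y : Fin (orthogonalRank A) → Tensor fun _ : Fin 3 => 3,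
      IsOrthogonalDecomposition A (orthogonalRank A) Y :=
  Nat.sInf_mem (exists_isOrthogonalDecomposition (by norm_num) A)

theorem one_div_sqrt_seven_le {A : Tensor fun _ : Fin 3 => 3} (hA : A ≠ 0) :
    1 / √7 ≤ tensorSpectralNorm A / ‖A‖ := by
  obtain ⟨Y, hY⟩ := exists_isOrthogonalDecomposition_orthogonalRank A
  have h := hY.norm_le hA
  have hpos := norm_pos_iff.2 hA
  have hS : 0 < tensorSpectralNorm A :=
    pos_of_mul_pos_right (hpos.trans_le h) (Real.sqrt_nonneg _)
  rw [div_le_div_iff₀ (by positivity) hpos, one_mul, mul_comm]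
  refine h.trans (mul_le_mul_of_nonneg_right (Real.sqrt_le_sqrt ?_) hS.le)
  exact_mod_cast orthogonalRank_le_seven A

/-- The norm inequality read backwards: with norm `√7` and spectral norm `1`, no decomposition is
shorter than `7`. -/
theorem orthogonalRank_chebyshevTensor {v : EuclideanSpace ℝ (Fin 3)} (hv : ‖v‖ = 1) :
    orthogonalRank (chebyshevTensor v) = 7 := by
  refine le_antisymm (orthogonalRank_le_seven _) ?_
  obtain ⟨Y, hY⟩ := exists_isOrthogonalDecomposition_orthogonalRank (chebyshevTensor v)
  have h := hY.norm_le (chebyshevTensor_ne_zero hv)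
  rw [norm_chebyshevTensor hv, tensorSpectralNorm_chebyshevTensor hv, mul_one,
    Real.sqrt_le_sqrt_iff (Nat.cast_nonneg _)] at h
  exact_mod_cast h

theorem isLeast_normRatios {V : Set (Tensor fun _ : Fin 3 => 3)}
    {v : EuclideanSpace ℝ (Fin 3)} (hv : ‖v‖ = 1) (hV : chebyshevTensor v ∈ V) :
    IsLeast (normRatios V) (1 / √7) := by
  refine ⟨⟨_, hV, chebyshevTensor_ne_zero hv, ?_⟩, ?_⟩
  · rw [tensorSpectralNorm_chebyshevTensor hv, norm_chebyshevTensor hv]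
  · rintro _ ⟨A, -, hA, rfl⟩
    exact one_div_sqrt_seven_le hA

theorem isGreatest_orthogonalRank :
    IsGreatest (Set.range (orthogonalRank : Tensor (fun _ : Fin 3 => 3) → ℕ)) 7 := by
  obtain ⟨v, hv, -⟩ := exists_formOfTensor_chebyshevTensor
  refine ⟨⟨_, orthogonalRank_chebyshevTensor hv⟩, ?_⟩
  rintro _ ⟨A, rfl⟩
  exact orthogonalRank_le_seven A

theorem one_div_sqrt_seven_le_uniformNorm {p : MvPolynomial (Fin 3) ℝ} (hp : p.IsHomogeneous 3)
    (h0 : p ≠ 0) : 1 / √7 ≤ uniformNorm p / bombieriNorm p := by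
  obtain ⟨A, hA, rfl⟩ := exists_symTensor_formOfTensor_eq hp
  rw [← tensorSpectralNorm_eq_uniformNorm hA, bombieriNorm_formOfTensor hA]
  refine one_div_sqrt_seven_le ?_
  rintro rfl
  exact h0 (by simp [formOfTensor])

end Extremal

/-! ### The main theorem. -/

theorem mainTheorem3 :
    -- the two ratios are minima, and both equal `1 / √7`
    (IsLeast (normRatios (Set.univ : Set (Tensor fun _ : Fin 3 => 3)))
        (bestRankOneRatio (Set.univ : Set (Tensor fun _ : Fin 3 => 3))) ∧
      IsLeast (normRatios (symTensors 3 3)) (bestRankOneRatio (symTensors 3 3)) ∧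
      bestRankOneRatio (Set.univ : Set (Tensor fun _ : Fin 3 => 3)) =
        bestRankOneRatio (symTensors 3 3) ∧
      bestRankOneRatio (symTensors 3 3) = 1 / √(maxOrthogonalRank fun _ : Fin 3 => 3 : ℕ) ∧
      1 / √(maxOrthogonalRank fun _ : Fin 3 => 3 : ℕ) = 1 / √7) ∧
    -- the maximal orthogonal rank is attained and equals seven
    (IsGreatest (Set.range (orthogonalRank : Tensor (fun _ : Fin 3 => 3) → ℕ))
        (maxOrthogonalRank fun _ : Fin 3 => 3) ∧
      maxOrthogonalRank (fun _ : Fin 3 => 3) = 7) ∧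
    -- the symmetric tensor corresponding to the Chebyshev cubic is extremal
    ((∃! A : Tensor fun _ : Fin 3 => 3, A ∈ symTensors 3 3 ∧ formOfTensor A = chebyshevCubic) ∧
      ∀ A ∈ symTensors 3 3, formOfTensor A = chebyshevCubic → IsExtremal A) ∧
    -- the inequality for ternary cubic forms, and its case of equality
    (∀ p : MvPolynomial (Fin 3) ℝ, p.IsHomogeneous 3 → p ≠ 0 →
      1 / √7 ≤ uniformNorm p / bombieriNorm p) ∧
    (∀ g : ConformalOrthogonalGroup 3,
      (conformalAction g chebyshevCubic).IsHomogeneous 3 ∧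
      conformalAction g chebyshevCubic ≠ 0 ∧
      uniformNorm (conformalAction g chebyshevCubic) /
        bombieriNorm (conformalAction g chebyshevCubic) = 1 / √7) := by
  obtain ⟨v, hv, hT⟩ := exists_formOfTensor_chebyshevTensor
  have hsym := chebyshevTensor_mem_symTensors v
  have h1 := isLeast_normRatios hv (Set.mem_univ (chebyshevTensor v))
  have h2 := isLeast_normRatios hv hsym
  have e1 : bestRankOneRatio (Set.univ : Set (Tensor fun _ : Fin 3 => 3)) = 1 / √7 := h1.csInf_eq
  have e2 : bestRankOneRatio (symTensors 3 3) = 1 / √7 := h2.csInf_eq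
  have e3 : maxOrthogonalRank (fun _ : Fin 3 => 3) = 7 := isGreatest_orthogonalRank.csSup_eq
  have e4 : ∀ A ∈ symTensors 3 3, formOfTensor A = chebyshevCubic → A = chebyshevTensor v :=
    fun A hA h => formOfTensor_injOn hA hsym (h.trans hT.symm)
  refine ⟨⟨by rwa [e1], by rwa [e2], by rw [e1, e2], by rw [e2, e3]; norm_num,
    by rw [e3]; norm_num⟩, ⟨by rw [e3]; exact isGreatest_orthogonalRank, e3⟩,
    ⟨⟨chebyshevTensor v, ⟨hsym, hT⟩, fun A hA => e4 A hA.1 hA.2⟩, ?_⟩,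
    fun p hp h0 => one_div_sqrt_seven_le_uniformNorm hp h0, fun g => ?_⟩
  · intro A hA h
    rw [e4 A hA h]
    refine ⟨chebyshevTensor_ne_zero hv, ?_⟩
    rwa [tensorSpectralNorm_chebyshevTensor hv, norm_chebyshevTensor hv]
  · obtain ⟨w, hw, h⟩ := exists_conformalAction_chebyshevCubic g
    have hs : (0 : ℝ) < g.1 := g.1.2
    have hu := uniformNorm_chebyshevTensor hw hs
    have hb := bombieriNorm_formOfTensor
      (smul_mem_symTensors (g.1 : ℝ) (chebyshevTensor_mem_symTensors w))
    rw [norm_smul, norm_chebyshevTensor hw, Real.norm_of_nonneg hs.le] at hb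
    rw [h]
    refine ⟨isHomogeneous_formOfTensor _, fun h0 => ?_, ?_⟩
    -- The Bombieri norm of the orbit form is `s * √7 > 0`, so the form is nonzero.
    · have hz : bombieriNorm (0 : MvPolynomial (Fin 3) ℝ) = 0 := by simp [bombieriNorm]
      rw [h0, hz] at hb
      exact absurd hb (by positivity)
    · rw [hu, hb]
      field_simp
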